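/- Let $c,d\in\mathbb{N}$ and $T>0$, let $H,Q_1,\dots,Q_c$ be $d\times d$ complex Hermitian matrices, and let $q\in\mathbb{R}^c$. For $\mu\in\mathbb{R}^c$ write $\mu\cdot q=\sum_i\mu_iq_i$, $\mu\cdot Q=\sum_i\mu_iQ_i$, and define $$f_T(\mu)=\mu\cdot q-T\,\mathrm{Tr}\!\left[\ln\!\left(e^{-\frac1T(H-\mu\cdot Q)}+I\right)\right],\qquad M_T(\mu)=\left(e^{\frac1T(H-\mu\cdot Q)}+I\right)^{-1},$$ $$M_T(\mu,s)=e^{\frac sT(H-\mu\cdot Q)}\left(e^{\frac1T(H-\mu\cdot Q)}+I\right)^{-1}\quad(s\in[0,1]),$$ $$\gamma(t)=\frac2\pi\ln\left|\coth\!\left(\frac{\pi t}{2}\right)\right|,\qquad \Phi_\mu(X)=\int_{-\infty}^{\infty}\gamma(t)\,e^{-i(H-\mu\cdot Q)t/T}\,X\,e^{i(H-\mu\cdot Q)t/T}\,dt .$$ Then $\gamma$ is a probability density on $\mathbb{R}$, $f_T$ is twice continuously differentiable, and for every $\mu\in\mathbb{R}^c$: each $M_T(\mu,s)$, $s\in[0,1]$,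 is a measurement operator (that is, $0\le M_T(\mu,s)\le I$), the map $\Phi_\mu$ is a quantum channel (linear, completely positive and trace preserving), and for all $i,j\in\{1,\dots,c\}$ $$\frac{\partial^2 f_T}{\partial\mu_i\,\partial\mu_j}(\mu)=-\frac1T\int_0^1\mathrm{Tr}\!\left[M_T(\mu,s)\,Q_i\,M_T(\mu,1-s)\,Q_j\right]ds=-\frac1T\,\mathrm{Re}\,\mathrm{Tr}\!\left[M_T(\mu)\,\Phi_\mu(Q_i)\,(I-M_T(\mu))\,Q_j\right].$$ -/

import Mathlib

open MeasureTheory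
open scoped ComplexOrder

noncomputable section

namespace FermiDirac

/-- The matrix `H - μ · Q`, where `μ · Q = ∑ i, μ i • Q i`. -/
def shifted {c d : ℕ} (H : Matrix (Fin d) (Fin d) ℂ) (Q : Fin c → Matrix (Fin d) (Fin d) ℂ)
    (μ : Fin c → ℝ) : Matrix (Fin d) (Fin d) ℂ :=
  H - ∑ i, μ i • Q i

/-- The matrix logarithm of a Hermitian matrix, by the continuous functional calculus. -/
def matrixLog {d : ℕ} (A : Matrix (Fin d) (Fin d) ℂ) : Matrix (Fin d) (Fin d) ℂ :=
  cfc Real.log A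

/-- The trace of the matrix logarithm is a real number, so that the real part taken in
`dualObjective` discards nothing. -/
theorem trace_matrixLog_im {d : ℕ} (A : Matrix (Fin d) (Fin d) ℂ) :
    ((matrixLog A).trace).im = 0 := by
  have h : star (matrixLog A) = matrixLog A := IsSelfAdjoint.cfc (f := Real.log) (a := A)
  have h2 : star ((matrixLog A).trace) = (matrixLog A).trace := by
    rw [← Matrix.trace_conjTranspose, ← Matrix.star_eq_conjTranspose, h]
  exact Complex.conj_eq_iff_im.mp h2

/-- The temperature-`T` dual objective function
`f_T(μ) = μ · q - T Tr[ln(e^{-(H - μ · Q)/T} + I)]`. -/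
def dualObjective {c d : ℕ} (T : ℝ) (H : Matrix (Fin d) (Fin d) ℂ)
    (Q : Fin c → Matrix (Fin d) (Fin d) ℂ) (q : Fin c → ℝ) (μ : Fin c → ℝ) : ℝ :=
  ∑ i, μ i * q i -
    T * (matrixLog (NormedSpace.exp (-((1 / T) • shifted H Q μ)) + 1)).trace.re

/-- The Fermi-Dirac measurement operator `M_T(μ) = (e^{(H - μ · Q)/T} + I)⁻¹`. -/
def fdOp {c d : ℕ} (T : ℝ) (H : Matrix (Fin d) (Fin d) ℂ)
    (Q : Fin c → Matrix (Fin d) (Fin d) ℂ) (μ : Fin c → ℝ) : Matrix (Fin d) (Fin d) ℂ :=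
  (NormedSpace.exp ((1 / T) • shifted H Q μ) + 1)⁻¹

/-- `M_T(μ, s) = e^{s(H - μ · Q)/T} / (e^{(H - μ · Q)/T} + I)`; numerator and denominator
commute. -/
def fdOpAt {c d : ℕ} (T : ℝ) (H : Matrix (Fin d) (Fin d) ℂ)
    (Q : Fin c → Matrix (Fin d) (Fin d) ℂ) (μ : Fin c → ℝ) (s : ℝ) :
    Matrix (Fin d) (Fin d) ℂ :=
  NormedSpace.exp ((s / T) • shifted H Q μ) *
    (NormedSpace.exp ((1 / T) • shifted H Q μ) + 1)⁻¹

/-- The high-peak tent density `γ(t) = (2/π) ln |coth(π t / 2)|`. The formula has no value at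
`t = 0`, where Lean's conventions give `0`; this is a null set. -/
def highPeakTent (t : ℝ) : ℝ :=
  2 / Real.pi * Real.log |Real.cosh (Real.pi * t / 2) / Real.sinh (Real.pi * t / 2)|

/-- `Φ_μ(X) = ∫ γ(t) e^{-i(H - μ · Q)t/T} X e^{i(H - μ · Q)t/T} dt`, the integral of a matrix
being taken entry by entry. -/
def tentChannel {c d : ℕ} (T : ℝ) (H : Matrix (Fin d) (Fin d) ℂ)
    (Q : Fin c → Matrix (Fin d) (Fin d) ℂ) (μ : Fin c → ℝ) (X : Matrix (Fin d) (Fin d) ℂ) :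
    Matrix (Fin d) (Fin d) ℂ :=
  Matrix.of fun a b => ∫ t : ℝ, (highPeakTent t : ℂ) *
    (NormedSpace.exp ((-(Complex.I * (t / T : ℂ))) • shifted H Q μ) * X *
      NormedSpace.exp ((Complex.I * (t / T : ℂ)) • shifted H Q μ)) a b

/-- `p` is a probability density on the real line. -/
def IsProbabilityDensity (p : ℝ → ℝ) : Prop :=
  (∀ t, 0 ≤ p t) ∧ Integrable p ∧ ∫ t, p t = 1

/-- `M` is a measurement operator: Hermitian with `0 ≤ M ≤ I`. -/
def IsMeasurementOperator {d : ℕ} (M : Matrix (Fin d) (Fin d) ℂ) : Prop :=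
  M.PosSemidef ∧ (1 - M).PosSemidef

/-- The ampliation `id_k ⊗ Φ`, which applies `Φ` to every `d × d` block of `X`. -/
def ampliation {d : ℕ} (Φ : Matrix (Fin d) (Fin d) ℂ → Matrix (Fin d) (Fin d) ℂ) (k : ℕ)
    (X : Matrix (Fin k × Fin d) (Fin k × Fin d) ℂ) :
    Matrix (Fin k × Fin d) (Fin k × Fin d) ℂ :=
  Matrix.of fun a b => Φ (Matrix.of fun x y => X (a.1, x) (b.1, y)) a.2 b.2

/-- A quantum channel: a linear, completely positive, trace-preserving map. -/
structure IsQuantumChannel {d : ℕ}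
    (Φ : Matrix (Fin d) (Fin d) ℂ → Matrix (Fin d) (Fin d) ℂ) : Prop where
  linear : IsLinearMap ℂ Φ
  completelyPositive : ∀ (k : ℕ) (X : Matrix (Fin k × Fin d) (Fin k × Fin d) ℂ),
    X.PosSemidef → (ampliation Φ k X).PosSemidef
  tracePreserving : ∀ X, (Φ X).trace = X.trace

/-- The partial derivative `∂f/∂μ_i`. -/
def partialDeriv {c : ℕ} (i : Fin c) (f : (Fin c → ℝ) → ℝ) (μ : Fin c → ℝ) : ℝ :=
  lineDeriv ℝ f μ (Pi.single i 1)

end FermiDirac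

end

/-! Put K = (H - μ·Q)/T. Since Tr ln B = ln det B for positive definite B, f_T is built from the
matrix exponential, the determinant and the real logarithm, hence smooth. Jacobi's and Duhamel's
formulas give ∂_j f_T = q_j - Re Tr[M_T(μ) Q_j], because under the trace the Duhamel integrand no
longer depends on s. Differentiating M_T = (e^K + I)⁻¹ gives -M_T (de^K) M_T, and the two outer
factors turn the Duhamel exponentials into M_T(μ, s) and M_T(μ, 1 - s).

The formula with Φ_μ is read in an eigenbasis of K, with eigenvalues l_a. There Φ_μ multiplies the
entry (a, b) by the Fourier transform of γ at l_a - l_b, which is tanh(ω/2)/(ω/2) with value 1 at ω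
= 0 (`tentTransform`). Both traces become double sums, and by `fdWeight_mul_tentTransform_add_swap`
the kernel of the s-integral is the symmetrization of the kernel of the channel expression. For
Hermitian Q_i, Q_j the real part sees only the symmetrization.

The multiplier matrix is positive semidefinite because γ ≥ 0, so the Schur product theorem makes Φ_μ
completely positive; its unit diagonal preserves the trace. The transform of γ comes from a series
of exponentials e^{-(2k+1)π|t|} integrated term by term and summed by the partial fractions of coth.
-/

noncomputable section

namespace FermiDirac

/-! ### The Fourier transform of the high-peak tent density -/

theorem exp_neg_abs_mul_exp_eqOn_Ioi (a ω : ℝ) :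
    Set.EqOn (fun t : ℝ => Complex.exp (((-a : ℝ) + Complex.I * ω) * t))
      (fun t : ℝ => ((Real.exp (-(a * |t|)) : ℝ) : ℂ) * Complex.exp (Complex.I * ω * t))
      (Set.Ioi 0) := by
  intro t ht
  have ht' : |t| = t := abs_of_pos ht
  simp only [ht']
  rw [Complex.ofReal_exp, ← Complex.exp_add]
  congr 1; push_cast; ring

theorem exp_neg_abs_mul_exp_eqOn_Iic (a ω : ℝ) :
    Set.EqOn (fun t : ℝ => Complex.exp (((a : ℝ) + Complex.I * ω) * t))
      (fun t : ℝ => ((Real.exp (-(a * |t|)) : ℝ) : ℂ) * Complex.exp (Complex.I * ω * t))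
      (Set.Iic 0) := by
  intro t ht
  have ht' : |t| = -t := abs_of_nonpos ht
  simp only [ht']
  rw [Complex.ofReal_exp, ← Complex.exp_add]
  congr 1; push_cast; ring

theorem integrableOn_Ioi_exp_neg_abs_mul_exp {a : ℝ} (ha : 0 < a) (ω : ℝ) :
    IntegrableOn (fun t : ℝ => ((Real.exp (-(a * |t|)) : ℝ) : ℂ) *
      Complex.exp (Complex.I * ω * t)) (Set.Ioi 0) :=
  (integrableOn_congr_fun (exp_neg_abs_mul_exp_eqOn_Ioi a ω) measurableSet_Ioi).mp
    (integrableOn_exp_mul_complex_Ioi (by simpa using ha) 0)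

theorem integrableOn_Iic_exp_neg_abs_mul_exp {a : ℝ} (ha : 0 < a) (ω : ℝ) :
    IntegrableOn (fun t : ℝ => ((Real.exp (-(a * |t|)) : ℝ) : ℂ) *
      Complex.exp (Complex.I * ω * t)) (Set.Iic 0) :=
  (integrableOn_congr_fun (exp_neg_abs_mul_exp_eqOn_Iic a ω) measurableSet_Iic).mp
    (integrableOn_exp_mul_complex_Iic (by simpa using ha) 0)

theorem integrable_exp_neg_abs_mul_exp {a : ℝ} (ha : 0 < a) (ω : ℝ) :
    Integrable (fun t : ℝ => ((Real.exp (-(a * |t|)) : ℝ) : ℂ) *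
      Complex.exp (Complex.I * ω * t)) := by
  rw [← integrableOn_univ, ← Set.Iic_union_Ioi (a := (0 : ℝ))]
  exact (integrableOn_Iic_exp_neg_abs_mul_exp ha ω).union
    (integrableOn_Ioi_exp_neg_abs_mul_exp ha ω)

theorem integral_exp_neg_abs_mul_exp {a : ℝ} (ha : 0 < a) (ω : ℝ) :
    ∫ t : ℝ, ((Real.exp (-(a * |t|)) : ℝ) : ℂ) * Complex.exp (Complex.I * ω * t) =
      ((2 * a / (a ^ 2 + ω ^ 2) : ℝ) : ℂ) := by
  rw [← intervalIntegral.integral_Iic_add_Ioi (integrableOn_Iic_exp_neg_abs_mul_exp ha ω)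
    (integrableOn_Ioi_exp_neg_abs_mul_exp ha ω),
    ← setIntegral_congr_fun measurableSet_Iic (exp_neg_abs_mul_exp_eqOn_Iic a ω),
    ← setIntegral_congr_fun measurableSet_Ioi (exp_neg_abs_mul_exp_eqOn_Ioi a ω),
    integral_exp_mul_complex_Iic (by simpa using ha),
    integral_exp_mul_complex_Ioi (by simpa using ha)]
  have h1 : ((a : ℝ) : ℂ) + Complex.I * ω ≠ 0 := fun h => by
    have := congrArg Complex.re h; simp at this; exact ha.ne' this
  have h2 : ((-a : ℝ) : ℂ) + Complex.I * ω ≠ 0 := fun h => by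
    have := congrArg Complex.re h; simp at this; exact ha.ne' this
  have h3 : ((a : ℂ) ^ 2 + (ω : ℂ) ^ 2) ≠ 0 := by
    have : a ^ 2 + ω ^ 2 ≠ 0 := by positivity
    exact_mod_cast this
  push_cast at h2 ⊢
  simp only [mul_zero, Complex.exp_zero]
  rw [div_add_div _ _ h1 h2, div_eq_div_iff (mul_ne_zero h1 h2) h3]
  linear_combination (-2 * a * ω ^ 2 : ℂ) * Complex.I_sq

theorem highPeakTent_neg (t : ℝ) : highPeakTent (-t) = highPeakTent t := by
  simp [highPeakTent, neg_div, div_neg]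

theorem highPeakTent_abs (t : ℝ) : highPeakTent |t| = highPeakTent t := by
  rcases abs_choice t with h | h <;> rw [h]
  exact highPeakTent_neg t

/-- With x = e^{-πt}, coth(πt/2) = (1 + x)/(1 - x), and ln((1 + x)/(1 - x)) is twice the sum of
x^{2k+1}/(2k+1). -/
theorem hasSum_highPeakTent_of_pos {t : ℝ} (ht : 0 < t) :
    HasSum (fun k : ℕ => 4 / Real.pi / (2 * k + 1) * Real.exp (-((2 * k + 1) * Real.pi * t)))
      (highPeakTent t) := by
  have hpt : 0 < Real.pi * t := by positivity
  set x := Real.exp (-(Real.pi * t)) with hx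
  have hx0 : 0 < x := Real.exp_pos _
  have hx1 : x < 1 := Real.exp_lt_one_iff.mpr (by linarith)
  have h := (Real.hasSum_log_sub_log_of_abs_lt_one (x := x)
    (by rw [abs_of_pos hx0]; exact hx1)).mul_left (2 / Real.pi)
  convert! h using 1
  · funext k
    rw [hx, ← Real.exp_nat_mul]
    push_cast
    rw [show (2 * (k : ℝ) + 1) * -(Real.pi * t) = -((2 * k + 1) * Real.pi * t) by ring]
    field_simp
    norm_num
  · rw [highPeakTent, ← Real.log_div (by linarith) (by linarith)]
    congr 2
    have he : Real.exp (Real.pi * t / 2) ≠ 0 := (Real.exp_pos _).ne'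
    have hx' : x = Real.exp (-(Real.pi * t / 2)) * Real.exp (-(Real.pi * t / 2)) := by
      rw [hx, ← Real.exp_add]; congr 1; ring
    have hs : 0 < Real.sinh (Real.pi * t / 2) := Real.sinh_pos_iff.mpr (by positivity)
    rw [abs_of_pos (div_pos (Real.cosh_pos _) hs), div_eq_div_iff hs.ne' (by linarith),
      Real.cosh_eq, Real.sinh_eq, hx', Real.exp_neg]
    field_simp

theorem hasSum_highPeakTent {t : ℝ} (ht : t ≠ 0) :
    HasSum (fun k : ℕ => 4 / Real.pi / (2 * k + 1) * Real.exp (-((2 * k + 1) * Real.pi * |t|)))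
      (highPeakTent t) := by
  simpa only [highPeakTent_abs] using hasSum_highPeakTent_of_pos (abs_pos.mpr ht)

theorem highPeakTent_nonneg (t : ℝ) : 0 ≤ highPeakTent t := by
  rcases eq_or_ne t 0 with rfl | ht
  · simp [highPeakTent]
  · exact (hasSum_highPeakTent ht).nonneg fun k => by positivity

theorem summable_one_div_odd_sq : Summable fun k : ℕ => 1 / (2 * (k : ℝ) + 1) ^ 2 := by
  have h := hasSum_zeta_two.summable.comp_injective
    (i := fun k : ℕ => 2 * k + 1) (fun a b h => by simpa using h)
  refine h.congr fun k => ?_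
  simp [Function.comp]

/-- Sum and integral may be exchanged because the L¹ norms of the terms decay like 1/(2k+1)². -/
theorem hasSum_integral_highPeakTent_mul_exp (ω : ℝ) :
    HasSum (fun k : ℕ => ((8 / (((2 * k + 1) * Real.pi) ^ 2 + ω ^ 2) : ℝ) : ℂ))
      (∫ t : ℝ, (highPeakTent t : ℂ) * Complex.exp (Complex.I * ω * t)) := by
  have hpos : ∀ k : ℕ, 0 < (2 * (k : ℝ) + 1) * Real.pi := fun k => by positivity
  set F : ℕ → ℝ → ℂ := fun k t => ((4 / Real.pi / (2 * k + 1) : ℝ) : ℂ) *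
    (((Real.exp (-((2 * k + 1) * Real.pi * |t|)) : ℝ) : ℂ) *
      Complex.exp (Complex.I * ω * t)) with hF
  -- The norm of a term is the same term at ω = 0, so the transform formula also computes the L¹
  -- norms.
  have hnorm : ∀ k t, ((‖F k t‖ : ℝ) : ℂ) = ((4 / Real.pi / (2 * k + 1) : ℝ) : ℂ) *
    (((Real.exp (-((2 * k + 1) * Real.pi * |t|)) : ℝ) : ℂ) *
      Complex.exp (Complex.I * (0 : ℝ) * t)) := by
    intro k t
    have h1 : ‖Complex.exp (Complex.I * ω * t)‖ = 1 := by
      rw [Complex.norm_exp]; simp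
    have h2 : (0 : ℝ) ≤ 4 / Real.pi / (2 * k + 1) := by positivity
    rw [hF]
    simp only [norm_mul, h1, Complex.norm_real, Real.norm_eq_abs, abs_of_nonneg h2, Real.abs_exp]
    simp
  have hsum : Summable fun k => ∫ t, ‖F k t‖ := by
    have : ∀ k, ∫ t, ‖F k t‖ = 8 / Real.pi ^ 2 * (1 / (2 * (k : ℝ) + 1) ^ 2) := by
      intro k
      apply Complex.ofReal_injective
      rw [← integral_complex_ofReal]
      simp_rw [hnorm]
      rw [integral_const_mul, integral_exp_neg_abs_mul_exp (hpos k), ← Complex.ofReal_mul]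
      congr 1
      have := hpos k
      field_simp
      ring
    simp_rw [this]
    exact summable_one_div_odd_sq.mul_left _
  have h := hasSum_integral_of_summable_integral_norm
    (fun k => (integrable_exp_neg_abs_mul_exp (hpos k) ω).const_mul _) hsum
  convert! h using 1
  · funext k
    rw [integral_const_mul, integral_exp_neg_abs_mul_exp (hpos k), ← Complex.ofReal_mul]
    congr 1
    have := hpos k
    field_simp
    ring
  · refine integral_congr_ae ?_
    filter_upwards [compl_mem_ae_iff.mpr (measure_singleton (0 : ℝ))] with t ht
    have h1 : t ≠ 0 := ht
    have h2 := (Complex.hasSum_ofReal.mpr (hasSum_highPeakTent h1)).mul_right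
      (Complex.exp (Complex.I * ω * t))
    rw [← h2.tsum_eq]
    refine tsum_congr fun k => ?_
    push_cast
    ring

/-! ### Summing the transform series: odd squares and partial fractions -/

theorem hasSum_one_div_odd_sq :
    HasSum (fun k : ℕ => 1 / (2 * (k : ℝ) + 1) ^ 2) (Real.pi ^ 2 / 8) := by
  have hz := hasSum_zeta_two
  have he : HasSum (fun k : ℕ => 1 / (((2 * k : ℕ) : ℝ)) ^ 2) (Real.pi ^ 2 / 24) := by
    convert! hz.mul_left (1 / 4) using 1
    · funext k
      push_cast
      rw [mul_pow, ← one_div_mul_one_div]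
      norm_num
    · ring
  have ho := summable_one_div_odd_sq.hasSum
  have ho' : HasSum (fun k : ℕ => 1 / (((2 * k + 1 : ℕ) : ℝ)) ^ 2)
      (∑' k : ℕ, 1 / (2 * (k : ℝ) + 1) ^ 2) := by
    simpa only [Nat.cast_add, Nat.cast_mul, Nat.cast_ofNat, Nat.cast_one] using ho
  have h := (HasSum.even_add_odd (f := fun n : ℕ => 1 / (n : ℝ) ^ 2) he ho').unique hz
  have : ∑' k : ℕ, 1 / (2 * (k : ℝ) + 1) ^ 2 = Real.pi ^ 2 / 8 := by linarith
  rwa [this] at ho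

/-- The partial fraction expansion of the hyperbolic cotangent. -/
theorem hasSum_coth {y : ℝ} (hy : y ≠ 0) :
    HasSum (fun n : ℕ => 2 * y / (y ^ 2 + ((n : ℝ) + 1) ^ 2))
      (Real.pi * (Real.cosh (Real.pi * y) / Real.sinh (Real.pi * y)) - 1 / y) := by
  -- The expansion is that of the cotangent at the imaginary point iy.
  have hz : Complex.I * y ∈ Complex.integerComplement := by
    rintro ⟨n, hn⟩
    have := congrArg Complex.im hn
    simp at this
    exact hy this.symm
  have hs : Real.sinh (Real.pi * y) ≠ 0 := by
    rw [Ne, Real.sinh_eq_zero]; positivity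
  have h1 := (summable_cotTerm hz).hasSum
  have h2 := cot_series_rep' hz
  rw [show (∑' n : ℕ, (1 / (Complex.I * y - (n + 1)) + 1 / (Complex.I * y + (n + 1)))) =
    ∑' n, cotTerm (Complex.I * y) n from rfl] at h2
  rw [← h2] at h1
  rw [← Complex.hasSum_ofReal]
  convert! h1.mul_left Complex.I using 1
  · funext n
    rw [cotTerm_identity hz]
    have h3 : ((y : ℂ) ^ 2 + ((n : ℂ) + 1) ^ 2) ≠ 0 := by
      have : y ^ 2 + ((n : ℝ) + 1) ^ 2 ≠ 0 := by positivity
      exact_mod_cast this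
    have h4 : (Complex.I * y + (n + 1)) * (Complex.I * y - (n + 1)) =
        -((y : ℂ) ^ 2 + ((n : ℂ) + 1) ^ 2) := by
      linear_combination (y ^ 2 : ℂ) * Complex.I_sq
    rw [h4]
    push_cast
    field_simp
    linear_combination (1 : ℂ) * Complex.I_sq
  · have hy' : (y : ℂ) ≠ 0 := by exact_mod_cast hy
    have hs' : Complex.sinh (Real.pi * y) ≠ 0 := by exact_mod_cast hs
    rw [Complex.cot, show (Real.pi : ℂ) * (Complex.I * y) = (Real.pi * y : ℂ) * Complex.I by ring,
      Complex.cos_mul_I, Complex.sin_mul_I]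
    push_cast
    field_simp

/-- The odd denominators are all denominators minus the even ones, and the even ones rescale to the
coth series at half the argument; the closed form is tanh u = 2 coth 2u - coth u. -/
theorem hasSum_tanh {ω : ℝ} (hω : ω ≠ 0) :
    HasSum (fun k : ℕ => 8 / (((2 * k + 1) * Real.pi) ^ 2 + ω ^ 2))
      (Real.tanh (ω / 2) / (ω / 2)) := by
  have hπ := Real.pi_pos
  set y := ω / Real.pi with hy
  have hy0 : y ≠ 0 := by positivity
  have hS := hasSum_coth hy0
  have hE := (hasSum_coth (y := y / 2) (by positivity)).mul_left (1 / 2)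
  set g : ℕ → ℝ := fun n => 2 * y / (y ^ 2 + ((n : ℝ) + 1) ^ 2) with hg
  -- The index n stands for the integer n + 1, so odd indices carry the even integers.
  have hodd : HasSum (fun k => g (2 * k + 1))
      (1 / 2 * (Real.pi * (Real.cosh (Real.pi * (y / 2)) / Real.sinh (Real.pi * (y / 2)))
        - 1 / (y / 2))) := by
    convert! hE using 1
    funext k
    simp only [hg]
    push_cast
    have h1 : 0 < y ^ 2 := by positivity
    field_simp
    ring
  have hev := (hS.summable.comp_injective
    (i := fun k : ℕ => 2 * k) (fun a b h => by simpa using h)).hasSum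
  have hev' := (HasSum.even_add_odd (f := g) hev hodd).unique hS
  have h8 := hev.mul_left (8 / (2 * y * Real.pi ^ 2))
  convert! h8 using 1
  · funext k
    simp only [Function.comp, hg, hy]
    push_cast
    have h1 : 0 < ω ^ 2 := by positivity
    field_simp
    ring
  · rw [eq_sub_of_add_eq hev', show Real.pi * y = 2 * (ω / 2) by rw [hy]; field_simp,
      show Real.pi * (y / 2) = ω / 2 by rw [hy]; field_simp, Real.cosh_two_mul,
      Real.sinh_two_mul, Real.tanh_eq_sinh_div_cosh, hy]
    have hc := (Real.cosh_pos (ω / 2)).ne'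
    have hs : Real.sinh (ω / 2) ≠ 0 := by rw [Ne, Real.sinh_eq_zero]; positivity
    field_simp
    ring

/-- The Fourier transform of the high-peak tent density. -/
def tentTransform (ω : ℝ) : ℝ := if ω = 0 then 1 else Real.tanh (ω / 2) / (ω / 2)

theorem integral_highPeakTent_mul_exp (ω : ℝ) :
    ∫ t : ℝ, (highPeakTent t : ℂ) * Complex.exp (Complex.I * ω * t) = (tentTransform ω : ℂ) := by
  refine (hasSum_integral_highPeakTent_mul_exp ω).unique (Complex.hasSum_ofReal.mpr ?_)
  rw [tentTransform]
  split_ifs with h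
  · subst h
    convert! hasSum_one_div_odd_sq.mul_left (8 / Real.pi ^ 2) using 1
    · funext k
      field_simp
      ring
    · field_simp
  · exact hasSum_tanh h

theorem integral_highPeakTent : ∫ t, highPeakTent t = 1 := by
  have h := integral_highPeakTent_mul_exp 0
  simp only [Complex.ofReal_zero, mul_zero, zero_mul, Complex.exp_zero, mul_one, tentTransform,
    if_true, integral_complex_ofReal] at h
  exact_mod_cast h

/-- A non-integrable function has Bochner integral 0 by convention, so the value 1 already forces
integrability. -/
theorem integrable_highPeakTent : Integrable highPeakTent := by
  by_contra h
  have h1 := integral_highPeakTent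
  rw [integral_undef h] at h1
  exact zero_ne_one h1

theorem isProbabilityDensity_highPeakTent : IsProbabilityDensity highPeakTent :=
  ⟨highPeakTent_nonneg, integrable_highPeakTent, integral_highPeakTent⟩

theorem integrable_highPeakTent_mul_exp (ω : ℝ) :
    Integrable fun t : ℝ => (highPeakTent t : ℂ) * Complex.exp (Complex.I * ω * t) := by
  refine integrable_highPeakTent.ofReal.mul_bdd (c := 1) (by fun_prop) ?_
  filter_upwards with t
  rw [Complex.norm_exp]; simp

theorem tentTransform_neg (ω : ℝ) : tentTransform (-ω) = tentTransform ω := by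
  simp [tentTransform, neg_div, Real.tanh_neg, div_neg]

/-! ### Derivatives of the exponential, the determinant and the inverse along a line -/

section Duhamel

variable {𝔸 : Type*} [NormedRing 𝔸] [NormedAlgebra ℝ 𝔸] [CompleteSpace 𝔸]

theorem continuous_normedSpace_exp : Continuous (NormedSpace.exp : 𝔸 → 𝔸) :=
  letI := NormedAlgebra.restrictScalars ℚ ℝ 𝔸
  NormedSpace.exp_continuous

/-- Duhamel's formula. -/
theorem exp_add_sub_exp (A X : 𝔸) :
    NormedSpace.exp (A + X) - NormedSpace.exp A =
      ∫ s in (0 : ℝ)..1, NormedSpace.exp (s • (A + X)) * X * NormedSpace.exp ((1 - s) • A) := by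
  have hc : Continuous (NormedSpace.exp : 𝔸 → 𝔸) := continuous_normedSpace_exp
  -- The Duhamel integrand is the derivative of a path from e^A at s = 0 to e^{A+X} at s = 1.
  have hd : ∀ s : ℝ, HasDerivAt
      (fun s : ℝ => NormedSpace.exp (s • (A + X)) * NormedSpace.exp ((1 - s) • A))
      (NormedSpace.exp (s • (A + X)) * X * NormedSpace.exp ((1 - s) • A)) s := by
    intro s
    have h1 := hasDerivAt_exp_smul_const (𝕂 := ℝ) (A + X) s
    have h2 := (hasDerivAt_exp_smul_const' (𝕂 := ℝ) A (1 - s)).scomp s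
      ((hasDerivAt_id s).const_sub 1)
    convert! h1.mul h2 using 1
    simp only [Function.comp, neg_smul, one_smul]
    noncomm_ring
  rw [intervalIntegral.integral_eq_sub_of_hasDerivAt (fun s _ => hd s)
    (Continuous.intervalIntegrable (by fun_prop) _ _)]
  simp

/-- Carathéodory's criterion: the difference quotient at 0 is g itself, so no remainder has to be
estimated. -/
theorem hasDerivAt_of_eq_add_smul {E : Type*} [NormedAddCommGroup E] [NormedSpace ℝ E]
    {f g : ℝ → E} (h : ∀ t, f t = f 0 + t • g t) (hg : ContinuousAt g 0) :
    HasDerivAt f (g 0) 0 := by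
  rw [hasDerivAt_iff_tendsto_slope]
  refine (hg.tendsto.mono_left nhdsWithin_le_nhds).congr' ?_
  filter_upwards [self_mem_nhdsWithin] with t ht
  have ht' : t ≠ 0 := ht
  rw [slope_def_module, h t, add_sub_cancel_left, sub_zero, smul_smul, inv_mul_cancel₀ ht',
    one_smul]

theorem hasDerivAt_exp_add_smul (A X : 𝔸) :
    HasDerivAt (fun t : ℝ => NormedSpace.exp (A + t • X))
      (∫ s in (0 : ℝ)..1, NormedSpace.exp (s • A) * X * NormedSpace.exp ((1 - s) • A)) 0 := by
  have hc : Continuous (NormedSpace.exp : 𝔸 → 𝔸) := continuous_normedSpace_exp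
  set g : ℝ → 𝔸 := fun t => ∫ s in (0 : ℝ)..1,
    NormedSpace.exp (s • (A + t • X)) * X * NormedSpace.exp ((1 - s) • A) with hg
  have hgc : Continuous g := by
    apply intervalIntegral.continuous_parametric_intervalIntegral_of_continuous'
    simp only [Function.uncurry_def]
    fun_prop
  have h := hasDerivAt_of_eq_add_smul (f := fun t : ℝ => NormedSpace.exp (A + t • X)) (g := g)
    (fun t => by
      have h1 := exp_add_sub_exp A (t • X)
      simp only [mul_smul_comm, smul_mul_assoc, intervalIntegral.integral_smul] at h1
      simp only [zero_smul, add_zero]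
      rw [← sub_eq_iff_eq_add', h1]) hgc.continuousAt
  simpa [hg] using h

end Duhamel

/-! ### Smoothness and derivatives of matrix functions -/

section Matrix

open scoped Matrix.Norms.Operator

variable {n : Type*} [Fintype n]

theorem contDiff_matrix_entry {k : WithTop ℕ∞} (i j : n) :
    ContDiff ℝ k fun A : Matrix n n ℂ => A i j :=
  (Matrix.entryLinearMap ℝ ℂ i j).toContinuousLinearMap.contDiff

variable [DecidableEq n]

theorem contDiff_matrix_det {k : WithTop ℕ∞} : ContDiff ℝ k fun A : Matrix n n ℂ => A.det := by
  simp only [Matrix.det_apply]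
  refine ContDiff.sum fun σ _ => ContDiff.const_smul _ ?_
  exact contDiff_prod fun i _ => contDiff_matrix_entry _ _

theorem contDiff_matrix_exp {k : WithTop ℕ∞} :
    ContDiff ℝ k fun A : Matrix n n ℂ => NormedSpace.exp A :=
  contDiff_iff_contDiffAt.mpr fun A =>
    (NormedSpace.exp_analytic (𝕂 := ℝ) A).contDiffAt

theorem hasDerivAt_det_add_smul {B : Matrix n n ℂ} (hB : IsUnit B) (X : Matrix n n ℂ) :
    HasDerivAt (fun t : ℝ => (B + t • X).det) (B.det * (B⁻¹ * X).trace) 0 := by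
  have hB' : IsUnit B.det := (Matrix.isUnit_iff_isUnit_det B).mp hB
  -- `P` collects the coefficients of degree at least two of det(1 + z B⁻¹X), divided by z².
  set P := (1 + (Polynomial.X : Polynomial ℂ) • (B⁻¹ * X).map Polynomial.C).det.divX.divX
  have h := hasDerivAt_of_eq_add_smul (f := fun t : ℝ => (B + t • X).det)
    (g := fun t : ℝ => B.det * ((B⁻¹ * X).trace + P.eval (t : ℂ) * t)) (fun t => by
      have h1 : B + t • X = B * (1 + (t : ℂ) • (B⁻¹ * X)) := by
        rw [mul_add, mul_one, mul_smul_comm, ← mul_assoc, Matrix.mul_nonsing_inv _ hB', one_mul,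
          Complex.coe_smul]
      simp only [zero_smul, add_zero]
      rw [h1, Matrix.det_mul, Matrix.det_one_add_smul, Complex.real_smul]
      ring) (by fun_prop)
  simpa using h

/-- Jacobi's formula. The Fréchet derivative of det in the direction `f'` is identified by
comparison with the straight line through `f t`. -/
theorem hasDerivAt_det {f : ℝ → Matrix n n ℂ} {f' : Matrix n n ℂ} {t : ℝ}
    (hf : HasDerivAt f f' t) (hu : IsUnit (f t)) :
    HasDerivAt (fun t => (f t).det) ((f t).det * ((f t)⁻¹ * f').trace) t := by
  have hd : DifferentiableAt ℝ (fun A : Matrix n n ℂ => A.det) (f t) :=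
    (contDiff_matrix_det (k := 1)).differentiable one_ne_zero _
  have h1 := hd.hasFDerivAt.comp_hasDerivAt t hf
  have hl : HasDerivAt (fun s : ℝ => f t + s • f') f' 0 := by
    have h := ((hasDerivAt_id (0 : ℝ)).smul_const f').const_add (f t)
    rwa [one_smul] at h
  have hd' : HasFDerivAt (fun A : Matrix n n ℂ => A.det)
      (fderiv ℝ (fun A : Matrix n n ℂ => A.det) (f t)) (f t + (0 : ℝ) • f') := by
    simpa using hd.hasFDerivAt
  have h2 := hd'.comp_hasDerivAt (0 : ℝ) hl
  have h3 := h2.unique (hasDerivAt_det_add_smul hu f')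
  rw [h3] at h1
  exact h1

theorem hasDerivAt_matrix_inv {f : ℝ → Matrix n n ℂ} {f' : Matrix n n ℂ} {t : ℝ}
    (hf : HasDerivAt f f' t) (hu : IsUnit (f t)) :
    HasDerivAt (fun t => (f t)⁻¹) (-((f t)⁻¹ * f' * (f t)⁻¹)) t := by
  obtain ⟨u, hu⟩ := hu
  have h1 := hasFDerivAt_ringInverse (𝕜 := ℝ) u
  rw [hu] at h1
  have h2 := h1.comp_hasDerivAt t hf
  convert! h2 using 1
  · funext s
    simp [Matrix.nonsing_inv_eq_ringInverse]
  · simp [← hu, Matrix.coe_units_inv]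

theorem hasDerivAt_trace_mul {f : ℝ → Matrix n n ℂ} {f' : Matrix n n ℂ} {t : ℝ}
    (hf : HasDerivAt f f' t) (C : Matrix n n ℂ) :
    HasDerivAt (fun t => (f t * C).trace) ((f' * C).trace) t := by
  let L : Matrix n n ℂ →ₗ[ℝ] ℂ :=
    (Matrix.traceLinearMap n ℝ ℂ).comp (LinearMap.mulRight ℝ C)
  exact L.toContinuousLinearMap.hasFDerivAt.comp_hasDerivAt t hf

theorem trace_mul_intervalIntegral_mul {F : ℝ → Matrix n n ℂ} (hF : Continuous F)
    (C D : Matrix n n ℂ) (a b : ℝ) :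
    (C * (∫ s in a..b, F s) * D).trace = ∫ s in a..b, (C * F s * D).trace := by
  let L : Matrix n n ℂ →ₗ[ℝ] ℂ :=
    (Matrix.traceLinearMap n ℝ ℂ).comp ((LinearMap.mulRight ℝ D).comp (LinearMap.mulLeft ℝ C))
  exact (L.toContinuousLinearMap.intervalIntegral_comp_comm
    (hF.intervalIntegrable a b)).symm

end Matrix

/-! ### The dual objective function and its derivatives -/

section Hermitian

theorem isHermitian_real_smul {n : Type*} {A : Matrix n n ℂ} (hA : A.IsHermitian) (x : ℝ) :
    (x • A).IsHermitian := by
  rw [Matrix.IsHermitian, Matrix.conjTranspose_smul, hA.eq, star_trivial]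

variable {n : Type*} [Fintype n] [DecidableEq n]

theorem commute_matrix_inv {A B : Matrix n n ℂ} (h : Commute A B) (hB : IsUnit B) :
    Commute A B⁻¹ := by
  obtain ⟨u, rfl⟩ := hB
  rw [← Matrix.coe_units_inv]
  exact h.units_inv_right

theorem commute_exp_smul_smul (A : Matrix n n ℂ) (x y : ℝ) :
    Commute (NormedSpace.exp (x • A)) (NormedSpace.exp (y • A)) := by
  have h : Commute (x • A) (y • A) := ((Commute.refl A).smul_left x).smul_right y
  rw [commute_iff_eq, ← Matrix.exp_add_of_commute _ _ h, add_comm,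
    Matrix.exp_add_of_commute _ _ h.symm]

theorem exp_smul_mul_exp_smul (A : Matrix n n ℂ) (x y : ℝ) :
    NormedSpace.exp (x • A) * NormedSpace.exp (y • A) = NormedSpace.exp ((x + y) • A) := by
  have h : Commute (x • A) (y • A) := ((Commute.refl A).smul_left x).smul_right y
  rw [← Matrix.exp_add_of_commute _ _ h, add_smul]

/-- e^A = (e^{A/2})* e^{A/2} is positive semidefinite, and adding the identity makes it definite. -/
theorem posDef_exp_add_one {A : Matrix n n ℂ} (hA : A.IsHermitian) :
    (NormedSpace.exp A + 1).PosDef := by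
  have h1 : NormedSpace.exp A =
      (NormedSpace.exp ((1 / 2 : ℝ) • A)).conjTranspose * NormedSpace.exp ((1 / 2 : ℝ) • A) := by
    rw [((isHermitian_real_smul hA _).exp).eq, exp_smul_mul_exp_smul]
    norm_num
  rw [h1]
  exact Matrix.PosDef.posSemidef_add (Matrix.posSemidef_conjTranspose_mul_self _) Matrix.PosDef.one

theorem isUnit_exp_add_one {A : Matrix n n ℂ} (hA : A.IsHermitian) :
    IsUnit (NormedSpace.exp A + 1) :=
  (posDef_exp_add_one hA).isUnit

theorem commute_exp_smul_exp_add_one_inv {A : Matrix n n ℂ} (hA : A.IsHermitian) (x : ℝ) :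
    Commute (NormedSpace.exp (x • A)) (NormedSpace.exp A + 1)⁻¹ := by
  refine commute_matrix_inv (Commute.add_right ?_ (Commute.one_right _)) (isUnit_exp_add_one hA)
  simpa using commute_exp_smul_smul A x 1

/-- Turns the logarithmic derivative of e^{-K} + I, which is what the objective produces, into the
Fermi-Dirac operator. -/
theorem exp_neg_add_one_inv_mul_exp_neg {A : Matrix n n ℂ} (hA : A.IsHermitian) :
    (NormedSpace.exp (-A) + 1)⁻¹ * NormedSpace.exp (-A) = (NormedSpace.exp A + 1)⁻¹ := by
  symm
  refine Matrix.inv_eq_left_inv ?_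
  have h : NormedSpace.exp (-A) * NormedSpace.exp A = 1 := by
    simpa using exp_smul_mul_exp_smul A (-1) 1
  rw [mul_assoc, mul_add, h, mul_one, add_comm 1]
  exact Matrix.nonsing_inv_mul _ ((Matrix.isUnit_iff_isUnit_det _).mp (isUnit_exp_add_one hA.neg))

open scoped Matrix.Norms.Operator in
/-- The derivative of the exponential, traced against a matrix commuting with the exponent. -/
theorem trace_exp_add_one_inv_mul_duhamel {A : Matrix n n ℂ} (hA : A.IsHermitian)
    (X : Matrix n n ℂ) :
    ((NormedSpace.exp A + 1)⁻¹ * ∫ s in (0 : ℝ)..1,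
      NormedSpace.exp (s • A) * X * NormedSpace.exp ((1 - s) • A)).trace =
    ((NormedSpace.exp A + 1)⁻¹ * NormedSpace.exp A * X).trace := by
  have hc : Continuous (NormedSpace.exp : Matrix n n ℂ → _) := continuous_normedSpace_exp
  have h := trace_mul_intervalIntegral_mul (F := fun s : ℝ =>
    NormedSpace.exp (s • A) * X * NormedSpace.exp ((1 - s) • A)) (by fun_prop)
    (NormedSpace.exp A + 1)⁻¹ 1 0 1
  rw [mul_one] at h
  have h2 : ∀ s : ℝ, ((NormedSpace.exp A + 1)⁻¹ *
      (NormedSpace.exp (s • A) * X * NormedSpace.exp ((1 - s) • A)) * 1).trace =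
      ((NormedSpace.exp A + 1)⁻¹ * NormedSpace.exp A * X).trace := by
    intro s
    -- Cyclicity brings e^{(1-s)A} next to e^{sA}; their product e^A is independent of s.
    rw [mul_one, ← mul_assoc, Matrix.trace_mul_comm, ← mul_assoc, ← mul_assoc,
      (commute_exp_smul_exp_add_one_inv hA (1 - s)).eq, mul_assoc (NormedSpace.exp A + 1)⁻¹,
      exp_smul_mul_exp_smul]
    simp
  exact h.trans ((intervalIntegral.integral_congr fun s _ => h2 s).trans (by simp))

/-- Replaces the functional calculus by the determinant, so that the logarithm of a matrix never has
to be differentiated. -/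
theorem trace_matrixLog_re {d : ℕ} {B : Matrix (Fin d) (Fin d) ℂ} (hB : B.PosDef) :
    (matrixLog B).trace.re = Real.log B.det.re := by
  have hdet : B.det.re = ∏ i, hB.1.eigenvalues i := by
    rw [hB.1.det_eq_prod_eigenvalues]
    simp [← Complex.ofReal_prod]
  rw [hdet, Real.log_prod fun i _ => (hB.eigenvalues_pos i).ne', matrixLog, hB.1.cfc_eq,
    Matrix.IsHermitian.cfc, Unitary.conjStarAlgAut_apply, Matrix.trace_mul_cycle,
    Unitary.coe_star_mul_self, one_mul]
  simp [Matrix.trace]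

end Hermitian

section Objective

variable {c d : ℕ} {T : ℝ} {H : Matrix (Fin d) (Fin d) ℂ}
  {Q : Fin c → Matrix (Fin d) (Fin d) ℂ} {q : Fin c → ℝ}

theorem isHermitian_shifted (hH : H.IsHermitian) (hQ : ∀ i, (Q i).IsHermitian)
    (μ : Fin c → ℝ) : (shifted H Q μ).IsHermitian := by
  refine hH.sub ?_
  rw [Matrix.IsHermitian, Matrix.conjTranspose_sum]
  exact Finset.sum_congr rfl fun i _ => (isHermitian_real_smul (hQ i) _).eq

theorem shifted_add_smul_single (H : Matrix (Fin d) (Fin d) ℂ)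
    (Q : Fin c → Matrix (Fin d) (Fin d) ℂ) (μ : Fin c → ℝ) (t : ℝ) (i : Fin c) :
    shifted H Q (μ + t • Pi.single i 1) = shifted H Q μ - t • Q i := by
  have h : ∑ k, (t • (Pi.single i (1 : ℝ) : Fin c → ℝ)) k • Q k = t • Q i := by
    rw [Finset.sum_eq_single i]
    · simp
    · intro k _ hk; simp [Pi.single_eq_of_ne hk]
    · simp
  simp only [shifted, Pi.add_apply, add_smul, Finset.sum_add_distrib]
  rw [h]
  abel

theorem dualObjective_eq (hH : H.IsHermitian) (hQ : ∀ i, (Q i).IsHermitian) (μ : Fin c → ℝ) :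
    dualObjective T H Q q μ = ∑ i, μ i * q i -
      T * Real.log (NormedSpace.exp (-((1 / T) • shifted H Q μ)) + 1).det.re := by
  rw [dualObjective, trace_matrixLog_re]
  exact posDef_exp_add_one (isHermitian_real_smul (isHermitian_shifted hH hQ μ) _).neg

open scoped Matrix.Norms.Operator in
theorem contDiff_dualObjective (hH : H.IsHermitian) (hQ : ∀ i, (Q i).IsHermitian)
    {k : WithTop ℕ∞} : ContDiff ℝ k (dualObjective T H Q q) := by
  rw [funext fun μ => dualObjective_eq (T := T) (q := q) hH hQ μ]
  have hs : ContDiff ℝ k fun μ : Fin c → ℝ => shifted H Q μ :=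
    contDiff_const.sub (ContDiff.sum fun i _ => (contDiff_apply ℝ ℝ i).smul contDiff_const)
  have hdet : ContDiff ℝ k fun μ : Fin c → ℝ =>
      (NormedSpace.exp (-((1 / T) • shifted H Q μ)) + 1).det.re :=
    Complex.reCLM.contDiff.comp (contDiff_matrix_det.comp
      ((contDiff_matrix_exp.comp (hs.const_smul _).neg).add contDiff_const))
  refine (ContDiff.sum fun i _ => (contDiff_apply ℝ ℝ i).mul contDiff_const).sub
    (contDiff_const.mul (hdet.log fun μ => ?_))
  exact (Complex.pos_iff.mp (posDef_exp_add_one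
    (isHermitian_real_smul (isHermitian_shifted hH hQ μ) _).neg).det_pos).1.ne'

open scoped Matrix.Norms.Operator in
theorem partialDeriv_dualObjective (hT : 0 < T) (hH : H.IsHermitian)
    (hQ : ∀ i, (Q i).IsHermitian) (j : Fin c) (μ : Fin c → ℝ) :
    partialDeriv j (dualObjective T H Q q) μ = q j - (fdOp T H Q μ * Q j).trace.re := by
  set K := (1 / T) • shifted H Q μ with hK
  have hKh : K.IsHermitian := isHermitian_real_smul (isHermitian_shifted hH hQ μ) _
  have hline : ∀ t : ℝ, -((1 / T) • shifted H Q (μ + t • Pi.single j 1)) =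
      -K + t • ((1 / T) • Q j) := by
    intro t
    rw [shifted_add_smul_single, smul_sub, hK, smul_comm t]
    abel
  have hE := (hasDerivAt_exp_add_smul (-K) ((1 / T) • Q j)).add_const (1 : Matrix _ _ ℂ)
  have h0 : -K + (0 : ℝ) • ((1 / T) • Q j) = -K := by simp
  have hdet := hasDerivAt_det hE (by rw [h0]; exact isUnit_exp_add_one hKh.neg)
  simp only [h0] at hdet
  have htr := (trace_exp_add_one_inv_mul_duhamel hKh.neg ((1 / T) • Q j)).trans
    (by rw [exp_neg_add_one_inv_mul_exp_neg hKh])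
  replace hdet := hdet.congr_deriv (congrArg (_ * ·) htr)
  have hpos := Complex.pos_iff.mp (posDef_exp_add_one hKh.neg).det_pos
  have hre : HasDerivAt (fun t : ℝ =>
      (NormedSpace.exp (-K + t • ((1 / T) • Q j)) + 1).det.re) _ 0 :=
    Complex.reCLM.hasFDerivAt.comp_hasDerivAt (0 : ℝ) hdet
  have hlog := hre.log (by simpa only [h0] using hpos.1.ne')
  have hlin : HasDerivAt (fun t : ℝ => ∑ i, (μ + t • (Pi.single j 1 : Fin c → ℝ)) i * q i) (q j) 0 := by
    have h1 : ∀ t : ℝ, ∑ i, (μ + t • (Pi.single j 1 : Fin c → ℝ)) i * q i =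
        ∑ i, μ i * q i + t * q j := by
      intro t
      simp [add_mul, Finset.sum_add_distrib, Pi.single_apply]
    simp only [h1]
    simpa using ((hasDerivAt_id (0 : ℝ)).mul_const (q j)).const_add (∑ i, μ i * q i)
  have hf := hlin.sub (hlog.const_mul T)
  rw [partialDeriv, lineDeriv]
  have hfun : (fun t : ℝ => dualObjective T H Q q (μ + t • Pi.single j 1)) = fun t : ℝ =>
      ∑ i, (μ + t • (Pi.single j 1 : Fin c → ℝ)) i * q i -
        T * Real.log (NormedSpace.exp (-K + t • ((1 / T) • Q j)) + 1).det.re := by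
    funext t
    rw [dualObjective_eq hH hQ, hline]
  rw [hfun]
  refine hf.deriv.trans ?_
  -- The determinant is a positive real, so it cancels from the logarithmic derivative even after
  -- real parts are taken.
  have hdiv : ∀ z w : ℂ, 0 < z.re → 0 = z.im → (z * w).re / z.re = w.re := by
    intro z w hz hz'
    rw [Complex.mul_re, ← hz', zero_mul, sub_zero, mul_div_cancel_left₀ _ hz.ne']
  simp only [h0, Complex.reCLM_apply]
  refine (congrArg (fun x => q j - T * x) (hdiv _ _ hpos.1 hpos.2)).trans ?_
  rw [fdOp, ← hK, mul_smul_comm, Matrix.trace_smul,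
    Complex.smul_re, smul_eq_mul, ← mul_assoc, mul_one_div_cancel hT.ne', one_mul]

theorem fdOpAt_eq (s : ℝ) (μ : Fin c → ℝ) : fdOpAt T H Q μ s =
    NormedSpace.exp (s • ((1 / T) • shifted H Q μ)) * fdOp T H Q μ := by
  rw [fdOpAt, fdOp, smul_smul, mul_one_div]

open scoped Matrix.Norms.Operator in
theorem hasDerivAt_trace_fdOp_mul (hH : H.IsHermitian) (hQ : ∀ i, (Q i).IsHermitian)
    (i : Fin c) (C : Matrix (Fin d) (Fin d) ℂ) (μ : Fin c → ℝ) :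
    HasDerivAt (fun t : ℝ => (fdOp T H Q (μ + t • Pi.single i 1) * C).trace)
      ((1 / T) • ∫ s in (0 : ℝ)..1,
        (fdOpAt T H Q μ s * Q i * fdOpAt T H Q μ (1 - s) * C).trace) 0 := by
  set K := (1 / T) • shifted H Q μ with hK
  have hKh : K.IsHermitian := isHermitian_real_smul (isHermitian_shifted hH hQ μ) _
  have hline : ∀ t : ℝ, fdOp T H Q (μ + t • Pi.single i 1) =
      (NormedSpace.exp (K + t • (-((1 / T) • Q i))) + 1)⁻¹ := by
    intro t
    rw [fdOp, shifted_add_smul_single, smul_sub, hK, smul_neg, smul_comm t, sub_eq_add_neg]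
  simp only [hline]
  have hE := (hasDerivAt_exp_add_smul K (-((1 / T) • Q i))).add_const (1 : Matrix _ _ ℂ)
  have h0 : K + (0 : ℝ) • (-((1 / T) • Q i)) = K := by simp
  have hinv := hasDerivAt_matrix_inv hE (by rw [h0]; exact isUnit_exp_add_one hKh)
  simp only [h0] at hinv
  have htr := hasDerivAt_trace_mul hinv C
  refine htr.congr_deriv ?_
  have hc : Continuous (NormedSpace.exp : Matrix (Fin d) (Fin d) ℂ → _) :=
    continuous_normedSpace_exp
  rw [neg_mul, Matrix.trace_neg, mul_assoc _ _ C, trace_mul_intervalIntegral_mul (by fun_prop),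
    ← intervalIntegral.integral_neg, ← intervalIntegral.integral_smul]
  refine intervalIntegral.integral_congr fun s _ => ?_
  simp only [fdOpAt_eq, ← hK]
  have hM : fdOp T H Q μ = (NormedSpace.exp K + 1)⁻¹ := rfl
  -- Only the left factor has to be reordered: on the right, e^{(1-s)K} already precedes the
  -- inverse.
  rw [hM, (commute_exp_smul_exp_add_one_inv hKh s).eq]
  simp only [mul_neg, neg_mul, Matrix.trace_neg, neg_neg, mul_smul_comm, smul_mul_assoc,
    Matrix.trace_smul, mul_assoc]
  rfl

theorem partialDeriv_partialDeriv_dualObjective (hT : 0 < T) (hH : H.IsHermitian)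
    (hQ : ∀ i, (Q i).IsHermitian) (i j : Fin c) (μ : Fin c → ℝ) :
    partialDeriv i (partialDeriv j (dualObjective T H Q q)) μ = -(1 / T) * (∫ s in (0 : ℝ)..1,
        (fdOpAt T H Q μ s * Q i * fdOpAt T H Q μ (1 - s) * Q j).trace).re := by
  rw [funext fun μ => partialDeriv_dualObjective (q := q) hT hH hQ j μ]
  have h := Complex.reCLM.hasFDerivAt.comp_hasDerivAt (0 : ℝ)
    (hasDerivAt_trace_fdOp_mul (T := T) hH hQ i (Q j) μ)
  rw [partialDeriv, lineDeriv]
  refine (h.const_sub (q j)).deriv.trans ?_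
  simp

end Objective

/-! ### Diagonalization -/

section Diagonalization

variable {c d : ℕ} {T : ℝ} {H : Matrix (Fin d) (Fin d) ℂ}
  {Q : Fin c → Matrix (Fin d) (Fin d) ℂ}

/-- `U` is a unitary matrix that diagonalizes `K`, with eigenvalues `l`. -/
structure Diagonalizes (U : Matrix (Fin d) (Fin d) ℂ) (l : Fin d → ℝ)
    (K : Matrix (Fin d) (Fin d) ℂ) : Prop where
  mul_conjTranspose : U * U.conjTranspose = 1
  conjTranspose_mul : U.conjTranspose * U = 1
  eq : K = U * Matrix.diagonal (fun a => (l a : ℂ)) * U.conjTranspose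

theorem exists_diagonalizes {K : Matrix (Fin d) (Fin d) ℂ} (hK : K.IsHermitian) :
    ∃ U l, Diagonalizes U l K := by
  refine ⟨hK.eigenvectorUnitary, hK.eigenvalues, ?_, ?_, ?_⟩
  · exact Unitary.coe_mul_star_self hK.eigenvectorUnitary
  · exact Unitary.coe_star_mul_self hK.eigenvectorUnitary
  · exact hK.spectral_theorem

variable {U : Matrix (Fin d) (Fin d) ℂ} {l : Fin d → ℝ} {K : Matrix (Fin d) (Fin d) ℂ}

theorem Diagonalizes.conj_mul_conj (h : Diagonalizes U l K) (A B : Matrix (Fin d) (Fin d) ℂ) :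
    (U * A * U.conjTranspose) * (U * B * U.conjTranspose) = U * (A * B) * U.conjTranspose := by
  calc _ = U * A * (U.conjTranspose * U) * B * U.conjTranspose := by simp only [mul_assoc]
    _ = _ := by rw [h.conjTranspose_mul, mul_one]; simp only [mul_assoc]

theorem Diagonalizes.conj_conj (h : Diagonalizes U l K) (A : Matrix (Fin d) (Fin d) ℂ) :
    U * (U.conjTranspose * A * U) * U.conjTranspose = A := by
  calc _ = (U * U.conjTranspose) * A * (U * U.conjTranspose) := by simp only [mul_assoc]
    _ = _ := by rw [h.mul_conjTranspose, mul_one, one_mul]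

theorem Diagonalizes.exp_smul (h : Diagonalizes U l K) (z : ℂ) :
    NormedSpace.exp (z • K) =
      U * Matrix.diagonal (fun a => Complex.exp (z * l a)) * U.conjTranspose := by
  have hU : IsUnit U := IsUnit.of_mul_eq_one _ h.mul_conjTranspose
  have hinv : U⁻¹ = U.conjTranspose := Matrix.inv_eq_right_inv h.mul_conjTranspose
  have h1 : z • K = U * Matrix.diagonal (fun a => z * (l a : ℂ)) * U⁻¹ := by
    rw [h.eq, hinv, ← smul_mul_assoc, ← mul_smul_comm, ← Matrix.diagonal_smul]
    rfl
  rw [h1, Matrix.exp_conj _ _ hU, Matrix.exp_diagonal, hinv]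
  congr 3
  funext a
  rw [Pi.coe_exp, Complex.exp_eq_exp_ℂ]

/-- The weight `e^{s x} / (e^x + 1)` by which `fdOpAt T H Q μ s` acts on an eigenvector. -/
def fdWeight (s x : ℝ) : ℝ := Real.exp (s * x) / (Real.exp x + 1)

theorem fdWeight_nonneg (s x : ℝ) : 0 ≤ fdWeight s x := by
  unfold fdWeight; positivity

/-- For s in [0, 1], e^{sx} is at most max(1, e^x). -/
theorem fdWeight_le_one {s : ℝ} (hs : s ∈ Set.Icc (0 : ℝ) 1) (x : ℝ) : fdWeight s x ≤ 1 := by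
  rw [fdWeight, div_le_one (by positivity)]
  rcases le_total 0 x with hx | hx
  · have : Real.exp (s * x) ≤ Real.exp x :=
      Real.exp_le_exp.mpr (mul_le_of_le_one_left hx hs.2)
    linarith
  · have h1 : Real.exp (s * x) ≤ 1 :=
      Real.exp_le_one_iff.mpr (mul_nonpos_of_nonneg_of_nonpos hs.1 hx)
    linarith [Real.exp_pos x]

theorem Diagonalizes.exp_real_smul (h : Diagonalizes U l K) (s : ℝ) :
    NormedSpace.exp (s • K) =
      U * Matrix.diagonal (fun a => ((Real.exp (s * l a) : ℝ) : ℂ)) * U.conjTranspose := by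
  rw [← Complex.coe_smul, h.exp_smul]
  push_cast
  rfl

theorem Diagonalizes.exp_add_one_inv (h : Diagonalizes U l K) :
    (NormedSpace.exp K + 1)⁻¹ =
      U * Matrix.diagonal (fun a => ((fdWeight 0 (l a) : ℝ) : ℂ)) * U.conjTranspose := by
  have h1 : NormedSpace.exp K + 1 =
      U * Matrix.diagonal (fun a => ((Real.exp (l a) + 1 : ℝ) : ℂ)) * U.conjTranspose := by
    have h2 := h.exp_real_smul 1
    simp only [one_smul, one_mul] at h2
    calc _ = U * Matrix.diagonal (fun a => ((Real.exp (l a) : ℝ) : ℂ)) * U.conjTranspose +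
          U * Matrix.diagonal (fun _ => (1 : ℂ)) * U.conjTranspose := by
          rw [h2, Matrix.diagonal_one, mul_one, h.mul_conjTranspose]
      _ = _ := by
          rw [← add_mul, ← mul_add, Matrix.diagonal_add]
          push_cast
          rfl
  refine Matrix.inv_eq_right_inv ?_
  rw [h1, h.conj_mul_conj, Matrix.diagonal_mul_diagonal]
  have h3 : ∀ a, ((Real.exp (l a) + 1 : ℝ) : ℂ) * ((fdWeight 0 (l a) : ℝ) : ℂ) = 1 := by
    intro a
    have : Real.exp (l a) + 1 ≠ 0 := by positivity
    rw [← Complex.ofReal_mul, fdWeight, zero_mul, Real.exp_zero, mul_one_div_cancel this,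
      Complex.ofReal_one]
  simp only [h3, Matrix.diagonal_one, mul_one, h.mul_conjTranspose]

variable {μ : Fin c → ℝ}

theorem Diagonalizes.fdOp_eq (h : Diagonalizes U l ((1 / T) • shifted H Q μ)) :
    fdOp T H Q μ =
      U * Matrix.diagonal (fun a => ((fdWeight 0 (l a) : ℝ) : ℂ)) * U.conjTranspose :=
  h.exp_add_one_inv

theorem Diagonalizes.fdOpAt_eq (h : Diagonalizes U l ((1 / T) • shifted H Q μ)) (s : ℝ) :
    fdOpAt T H Q μ s =
      U * Matrix.diagonal (fun a => ((fdWeight s (l a) : ℝ) : ℂ)) * U.conjTranspose := by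
  rw [FermiDirac.fdOpAt_eq, h.fdOp_eq, h.exp_real_smul, h.conj_mul_conj,
    Matrix.diagonal_mul_diagonal]
  simp only [← Complex.ofReal_mul, fdWeight, zero_mul, Real.exp_zero, mul_one_div]

theorem Diagonalizes.one_sub_conj_diagonal (h : Diagonalizes U l K) (v : Fin d → ℝ) :
    1 - U * Matrix.diagonal (fun a => ((v a : ℝ) : ℂ)) * U.conjTranspose =
      U * Matrix.diagonal (fun a => ((1 - v a : ℝ) : ℂ)) * U.conjTranspose := by
  calc _ = U * Matrix.diagonal (fun _ => (1 : ℂ)) * U.conjTranspose -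
        U * Matrix.diagonal (fun a => ((v a : ℝ) : ℂ)) * U.conjTranspose := by
        rw [Matrix.diagonal_one, mul_one, h.mul_conjTranspose]
    _ = _ := by
        rw [← sub_mul, ← mul_sub, Matrix.diagonal_sub]
        push_cast
        rfl

theorem posSemidef_conj_diagonal (U : Matrix (Fin d) (Fin d) ℂ) {v : Fin d → ℝ}
    (hv : ∀ a, 0 ≤ v a) :
    (U * Matrix.diagonal (fun a => ((v a : ℝ) : ℂ)) * U.conjTranspose).PosSemidef :=
  (Matrix.PosSemidef.diagonal fun a => Complex.zero_le_real.mpr (hv a)).mul_mul_conjTranspose_same U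

theorem Diagonalizes.isMeasurementOperator_fdOpAt
    (h : Diagonalizes U l ((1 / T) • shifted H Q μ)) {s : ℝ} (hs : s ∈ Set.Icc (0 : ℝ) 1) :
    IsMeasurementOperator (fdOpAt T H Q μ s) := by
  rw [IsMeasurementOperator, h.fdOpAt_eq, h.one_sub_conj_diagonal]
  exact ⟨posSemidef_conj_diagonal U fun a => fdWeight_nonneg _ _,
    posSemidef_conj_diagonal U fun a => sub_nonneg.mpr (fdWeight_le_one hs _)⟩

theorem Diagonalizes.one_sub_fdOp_eq (h : Diagonalizes U l ((1 / T) • shifted H Q μ)) :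
    1 - fdOp T H Q μ =
      U * Matrix.diagonal (fun a => ((fdWeight 1 (l a) : ℝ) : ℂ)) * U.conjTranspose := by
  rw [h.fdOp_eq, h.one_sub_conj_diagonal]
  have h1 : ∀ x : ℝ, 1 - fdWeight 0 x = fdWeight 1 x := by
    intro x
    have : Real.exp x + 1 ≠ 0 := by positivity
    rw [fdWeight, fdWeight, zero_mul, Real.exp_zero, one_mul]
    field_simp
    ring
  simp only [h1]

/-- The common form of both Hessian expressions. `Z` is arbitrary so as to cover the rotated Q_i as
well as its entrywise product with `tentKernel`. -/
theorem Diagonalizes.trace_conj (h : Diagonalizes U l K) (v w : Fin d → ℂ)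
    (Z R : Matrix (Fin d) (Fin d) ℂ) :
    ((U * Matrix.diagonal v * U.conjTranspose) * (U * Z * U.conjTranspose) *
      (U * Matrix.diagonal w * U.conjTranspose) * R).trace =
    ∑ a, ∑ b, v a * Z a b * w b * (U.conjTranspose * R * U) b a := by
  rw [h.conj_mul_conj, h.conj_mul_conj]
  have h1 : (U * (Matrix.diagonal v * Z * Matrix.diagonal w) * U.conjTranspose * R).trace =
      (Matrix.diagonal v * Z * Matrix.diagonal w * (U.conjTranspose * R * U)).trace := by
    rw [mul_assoc, mul_assoc, Matrix.trace_mul_comm]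
    simp only [mul_assoc]
  rw [h1, Matrix.trace]
  refine Finset.sum_congr rfl fun a _ => ?_
  rw [Matrix.diag_apply, Matrix.mul_apply]
  refine Finset.sum_congr rfl fun b _ => ?_
  rw [Matrix.mul_diagonal, Matrix.diagonal_mul]

/-! ### The tent channel -/

theorem smul_eq_smul_one_div_smul (w : ℂ) (t : ℝ) (A : Matrix (Fin d) (Fin d) ℂ) :
    (w * (t / T : ℂ)) • A = (w * t) • ((1 / T) • A) := by
  rw [← Complex.coe_smul (1 / T), smul_smul]
  congr 1
  push_cast
  ring

/-- The matrix of Fourier coefficients by which the tent channel acts in an eigenbasis. -/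
def tentKernel (l : Fin d → ℝ) : Matrix (Fin d) (Fin d) ℂ :=
  Matrix.of fun a b => ((tentTransform (l a - l b) : ℝ) : ℂ)

/-- In the eigenbasis the unitary conjugation multiplies the entry (x, y) by e^{i(l_y - l_x)t};
integration against γ gives `tentTransform`, whose evenness fixes the sign. -/
theorem Diagonalizes.tentChannel_eq (h : Diagonalizes U l ((1 / T) • shifted H Q μ))
    (X : Matrix (Fin d) (Fin d) ℂ) :
    tentChannel T H Q μ X =
      U * (tentKernel l).hadamard (U.conjTranspose * X * U) * U.conjTranspose := by
  set Y := U.conjTranspose * X * U with hY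
  have hX : X = U * Y * U.conjTranspose := (h.conj_conj X).symm
  ext a b
  have hint : ∀ t : ℝ, (highPeakTent t : ℂ) *
      (NormedSpace.exp ((-(Complex.I * (t / T : ℂ))) • shifted H Q μ) * X *
        NormedSpace.exp ((Complex.I * (t / T : ℂ)) • shifted H Q μ)) a b =
      ∑ y, ∑ x, U a x * Y x y * U.conjTranspose y b *
        ((highPeakTent t : ℂ) * Complex.exp (Complex.I * ((l y - l x : ℝ) : ℂ) * t)) := by
    intro t
    rw [← neg_mul, smul_eq_smul_one_div_smul, smul_eq_smul_one_div_smul, h.exp_smul, h.exp_smul]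
    nth_rw 1 [hX]
    rw [h.conj_mul_conj, h.conj_mul_conj, Matrix.mul_apply, Finset.mul_sum]
    refine Finset.sum_congr rfl fun y _ => ?_
    rw [Matrix.mul_apply, Finset.sum_mul, Finset.mul_sum]
    refine Finset.sum_congr rfl fun x _ => ?_
    rw [Matrix.mul_diagonal, Matrix.diagonal_mul]
    have he : Complex.exp (Complex.I * ((l y - l x : ℝ) : ℂ) * t) =
        Complex.exp (-Complex.I * t * l x) * Complex.exp (Complex.I * t * l y) := by
      rw [← Complex.exp_add]
      congr 1
      push_cast
      ring
    rw [he]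
    ring
  rw [tentChannel, Matrix.of_apply]
  simp only [hint]
  rw [integral_finsetSum _ fun y _ => integrable_finsetSum _ fun x _ =>
    (integrable_highPeakTent_mul_exp _).const_mul _, Matrix.mul_apply]
  refine Finset.sum_congr rfl fun y _ => ?_
  rw [integral_finsetSum _ fun x _ => (integrable_highPeakTent_mul_exp _).const_mul _,
    Matrix.mul_apply, Finset.sum_mul]
  refine Finset.sum_congr rfl fun x _ => ?_
  rw [integral_const_mul, integral_highPeakTent_mul_exp, Matrix.hadamard_apply, tentKernel,
    Matrix.of_apply, ← tentTransform_neg (l x - l y), neg_sub]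
  ring

/-- The easy half of Bochner's theorem: the quadratic form is the integral of γ(t) |∑ conj(x_a) e^{i
l_a t}|². -/
theorem posSemidef_tentKernel (l : Fin d → ℝ) : (tentKernel l).PosSemidef := by
  refine Matrix.PosSemidef.of_dotProduct_mulVec_nonneg ?_ fun x => ?_
  · ext a b
    rw [Matrix.conjTranspose_apply, tentKernel, Matrix.of_apply, Matrix.of_apply,
      ← tentTransform_neg, neg_sub]
    exact Complex.conj_ofReal _
  · have h1 : star x ⬝ᵥ (tentKernel l).mulVec x = ∑ a, ∑ b, ∫ t : ℝ, (star (x a) * x b) *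
        ((highPeakTent t : ℂ) * Complex.exp (Complex.I * ((l a - l b : ℝ) : ℂ) * t)) := by
      simp only [dotProduct, Matrix.mulVec, Finset.mul_sum]
      refine Finset.sum_congr rfl fun a _ => Finset.sum_congr rfl fun b _ => ?_
      rw [integral_const_mul, integral_highPeakTent_mul_exp, tentKernel, Matrix.of_apply,
        Pi.star_apply]
      ring
    have h2 : ∀ t : ℝ, ∑ a, ∑ b, (star (x a) * x b) *
        ((highPeakTent t : ℂ) * Complex.exp (Complex.I * ((l a - l b : ℝ) : ℂ) * t)) =
        ((highPeakTent t *
          Complex.normSq (∑ a, star (x a) * Complex.exp (Complex.I * l a * t)) : ℝ) : ℂ) := by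
      intro t
      rw [Complex.ofReal_mul, ← Complex.mul_conj, map_sum, Finset.sum_mul_sum, Finset.mul_sum]
      refine Finset.sum_congr rfl fun a _ => ?_
      rw [Finset.mul_sum]
      refine Finset.sum_congr rfl fun b _ => ?_
      have he : Complex.exp (Complex.I * ((l a - l b : ℝ) : ℂ) * t) =
          Complex.exp (Complex.I * l a * t) *
            (starRingEnd ℂ) (Complex.exp (Complex.I * l b * t)) := by
        rw [← Complex.exp_conj, ← Complex.exp_add]
        congr 1
        simp
        ring
      rw [he, map_mul, ← starRingEnd_apply (x b), Complex.conj_conj]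
      ring
    rw [h1]
    simp_rw [← integral_finsetSum _ fun b _ =>
      (integrable_highPeakTent_mul_exp _).const_mul _]
    rw [← integral_finsetSum _ fun a _ => integrable_finsetSum _ fun b _ =>
      (integrable_highPeakTent_mul_exp _).const_mul _]
    simp only [h2]
    rw [integral_complex_ofReal]
    exact Complex.zero_le_real.mpr (integral_nonneg fun t =>
      mul_nonneg (highPeakTent_nonneg t) (Complex.normSq_nonneg _))

/-- The ampliation `1 ⊗ U` of a matrix. -/
def blockExtend (k : ℕ) (U : Matrix (Fin d) (Fin d) ℂ) :
    Matrix (Fin k × Fin d) (Fin k × Fin d) ℂ :=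
  Matrix.of fun p q => if p.1 = q.1 then U p.2 q.2 else 0

theorem blockExtend_conjTranspose (k : ℕ) (U : Matrix (Fin d) (Fin d) ℂ) :
    (blockExtend k U).conjTranspose = blockExtend k U.conjTranspose := by
  ext p q
  simp only [Matrix.conjTranspose_apply, blockExtend, Matrix.of_apply, eq_comm (a := q.1)]
  split_ifs <;> simp

theorem blockExtend_mul_mul_apply (k : ℕ) (U V : Matrix (Fin d) (Fin d) ℂ)
    (Z : Matrix (Fin k × Fin d) (Fin k × Fin d) ℂ) (p q : Fin k × Fin d) :
    (blockExtend k U * Z * blockExtend k V) p q =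
      (U * (Matrix.of fun x y => Z (p.1, x) (q.1, y)) * V) p.2 q.2 := by
  simp [Matrix.mul_apply, blockExtend, Fintype.sum_prod_type]

/-- The ampliation is again entrywise multiplication in a rotated basis. Its multiplier repeats
`tentKernel` in every block and, being a `submatrix` of it, stays positive semidefinite. -/
theorem Diagonalizes.ampliation_tentChannel_eq
    (h : Diagonalizes U l ((1 / T) • shifted H Q μ)) (k : ℕ)
    (X : Matrix (Fin k × Fin d) (Fin k × Fin d) ℂ) :
    ampliation (tentChannel T H Q μ) k X =
      blockExtend k U * ((tentKernel l).submatrix Prod.snd Prod.snd).hadamard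
        ((blockExtend k U).conjTranspose * X * blockExtend k U) *
          (blockExtend k U).conjTranspose := by
  ext p q
  rw [blockExtend_conjTranspose, blockExtend_mul_mul_apply, ampliation, Matrix.of_apply,
    h.tentChannel_eq]
  refine congrArg (fun Z : Matrix (Fin d) (Fin d) ℂ => (U * Z * U.conjTranspose) p.2 q.2) ?_
  ext x y
  simp only [Matrix.hadamard_apply, Matrix.of_apply, Matrix.submatrix_apply,
    blockExtend_mul_mul_apply]

theorem Diagonalizes.isQuantumChannel_tentChannel
    (h : Diagonalizes U l ((1 / T) • shifted H Q μ)) :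
    IsQuantumChannel (tentChannel T H Q μ) where
  linear := by
    constructor
    · intro X Y
      simp only [h.tentChannel_eq, mul_add, add_mul, Matrix.hadamard_add]
    · intro r X
      simp only [h.tentChannel_eq, mul_smul_comm, smul_mul_assoc, Matrix.hadamard_smul]
  completelyPositive := by
    intro k X hX
    rw [h.ampliation_tentChannel_eq]
    exact (((posSemidef_tentKernel l).submatrix _).hadamard
      (hX.conjTranspose_mul_mul_same _)).mul_mul_conjTranspose_same _
  tracePreserving := by
    intro X
    rw [h.tentChannel_eq, Matrix.trace_mul_cycle, h.conjTranspose_mul, one_mul]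
    have h1 : ((tentKernel l).hadamard (U.conjTranspose * X * U)).trace =
        (U.conjTranspose * X * U).trace :=
      Finset.sum_congr rfl fun a _ => by
        simp [Matrix.hadamard_apply, tentKernel, tentTransform]
    rw [h1, Matrix.trace_mul_cycle, h.mul_conjTranspose, one_mul]

/-! ### The kernel of the Hessian in an eigenbasis -/

/-- The kernel `∫₀¹ e^{s x + (1 - s) y} / ((e^x + 1) (e^y + 1)) ds` of the Hessian. -/
def hessianKernel (x y : ℝ) : ℝ := ∫ s in (0 : ℝ)..1, fdWeight s x * fdWeight (1 - s) y

/-- Substitute s ↦ 1 - s. This symmetry makes the Hessian integral real. -/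
theorem hessianKernel_comm (x y : ℝ) : hessianKernel x y = hessianKernel y x := by
  have h := intervalIntegral.integral_comp_sub_left (a := 0) (b := 1)
    (fun s => fdWeight s y * fdWeight (1 - s) x) 1
  simp only [sub_sub_cancel, sub_self, sub_zero] at h
  rw [hessianKernel, hessianKernel, ← h]
  exact intervalIntegral.integral_congr fun s _ => mul_comm _ _

theorem continuous_fdWeight (x : ℝ) : Continuous fun s => fdWeight s x := by
  unfold fdWeight
  fun_prop

theorem tanh_half_sub (x y : ℝ) :
    Real.tanh ((x - y) / 2) = (Real.exp x - Real.exp y) / (Real.exp x + Real.exp y) := by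
  have hx : Real.exp x = Real.exp (x / 2) * Real.exp (x / 2) := by
    rw [← Real.exp_add, add_halves]
  have hy : Real.exp y = Real.exp (y / 2) * Real.exp (y / 2) := by
    rw [← Real.exp_add, add_halves]
  have h1 : Real.exp ((x - y) / 2) = Real.exp (x / 2) / Real.exp (y / 2) := by
    rw [← Real.exp_sub]; congr 1; ring
  have h2 : Real.exp (-((x - y) / 2)) = Real.exp (y / 2) / Real.exp (x / 2) := by
    rw [← Real.exp_sub]; congr 1; ring
  have := Real.exp_pos (x / 2)
  have := Real.exp_pos (y / 2)
  rw [Real.tanh_eq_sinh_div_cosh, Real.sinh_eq, Real.cosh_eq, h1, h2, hx, hy]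
  field_simp

theorem hessianKernel_eq_of_ne {x y : ℝ} (hxy : x ≠ y) : hessianKernel x y =
    (Real.exp x - Real.exp y) / ((x - y) * ((Real.exp x + 1) * (Real.exp y + 1))) := by
  have hne : x - y ≠ 0 := sub_ne_zero.mpr hxy
  have hx : Real.exp x + 1 ≠ 0 := by positivity
  have hy : Real.exp y + 1 ≠ 0 := by positivity
  have h1 : ∀ s : ℝ, fdWeight s x * fdWeight (1 - s) y =
      Real.exp y / ((Real.exp x + 1) * (Real.exp y + 1)) * Real.exp ((x - y) * s) := by
    intro s
    rw [fdWeight, fdWeight, div_mul_div_comm, ← Real.exp_add, div_mul_eq_mul_div,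
      ← Real.exp_add]
    congr 2
    ring
  have h2 : Real.exp y * Real.exp (x - y) = Real.exp x := by
    rw [← Real.exp_add]; congr 1; ring
  rw [hessianKernel]
  simp only [h1]
  rw [intervalIntegral.integral_const_mul, intervalIntegral.integral_comp_mul_left _ hne,
    integral_exp, mul_zero, mul_one, Real.exp_zero, smul_eq_mul]
  field_simp
  rw [mul_sub, h2, mul_one]

theorem hessianKernel_self (x : ℝ) :
    hessianKernel x x = Real.exp x / ((Real.exp x + 1) * (Real.exp x + 1)) := by
  have h1 : ∀ s : ℝ, fdWeight s x * fdWeight (1 - s) x =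
      Real.exp x / ((Real.exp x + 1) * (Real.exp x + 1)) := by
    intro s
    rw [fdWeight, fdWeight, div_mul_div_comm, ← Real.exp_add]
    congr 2
    ring
  simp [hessianKernel, h1]

/-- The identity linking the two Hessian formulas. The weights add up to (e^x + e^y)/((e^x + 1)(e^y
+ 1)), and e^x + e^y cancels the denominator of tanh((x - y)/2) = (e^x - e^y)/(e^x + e^y). The
diagonal x = y is separate, since there the transform is 1 by definition. -/
theorem fdWeight_mul_tentTransform_add_swap (x y : ℝ) :
    fdWeight 0 x * tentTransform (x - y) * fdWeight 1 y +
      fdWeight 0 y * tentTransform (y - x) * fdWeight 1 x = 2 * hessianKernel x y := by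
  have hx : Real.exp x + 1 ≠ 0 := by positivity
  have hy : Real.exp y + 1 ≠ 0 := by positivity
  rw [← neg_sub x y, tentTransform_neg]
  simp only [fdWeight, zero_mul, Real.exp_zero, one_mul]
  rcases eq_or_ne x y with rfl | hxy
  · rw [hessianKernel_self, sub_self, tentTransform, if_pos rfl]
    field_simp
    ring
  · have hne : x - y ≠ 0 := sub_ne_zero.mpr hxy
    have hp : Real.exp x + Real.exp y ≠ 0 := by positivity
    rw [hessianKernel_eq_of_ne hxy, tentTransform, if_neg hne, tanh_half_sub]
    field_simp
    ring

/-! ### The two traces as double sums over an eigenbasis -/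

theorem Diagonalizes.integral_trace_eq (h : Diagonalizes U l ((1 / T) • shifted H Q μ))
    (A B : Matrix (Fin d) (Fin d) ℂ) :
    ∫ s in (0 : ℝ)..1, (fdOpAt T H Q μ s * A * fdOpAt T H Q μ (1 - s) * B).trace =
      ∑ a, ∑ b, (hessianKernel (l a) (l b) : ℂ) *
        ((U.conjTranspose * A * U) a b * (U.conjTranspose * B * U) b a) := by
  set A' := U.conjTranspose * A * U with hA'
  set B' := U.conjTranspose * B * U with hB'
  have h1 : ∀ s : ℝ, (fdOpAt T H Q μ s * A * fdOpAt T H Q μ (1 - s) * B).trace =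
      ∑ a, ∑ b, ((fdWeight s (l a) * fdWeight (1 - s) (l b) : ℝ) : ℂ) * (A' a b * B' b a) := by
    intro s
    rw [h.fdOpAt_eq, h.fdOpAt_eq, ← h.conj_conj A, h.trace_conj]
    refine Finset.sum_congr rfl fun a _ => Finset.sum_congr rfl fun b _ => ?_
    push_cast
    ring
  have hc : ∀ a b, Continuous fun s : ℝ =>
      ((fdWeight s (l a) * fdWeight (1 - s) (l b) : ℝ) : ℂ) * (A' a b * B' b a) := fun a b =>
    (Complex.continuous_ofReal.comp ((continuous_fdWeight (l a)).mul
      ((continuous_fdWeight (l b)).comp (continuous_const.sub continuous_id)))).mul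
        continuous_const
  simp only [h1]
  rw [intervalIntegral.integral_finsetSum fun a _ => Continuous.intervalIntegrable
    (continuous_finsetSum _ fun b _ => hc a b) _ _]
  refine Finset.sum_congr rfl fun a _ => ?_
  rw [intervalIntegral.integral_finsetSum fun b _ => (hc a b).intervalIntegrable _ _]
  refine Finset.sum_congr rfl fun b _ => ?_
  rw [intervalIntegral.integral_mul_const, intervalIntegral.integral_ofReal, hessianKernel]

theorem Diagonalizes.trace_tentChannel_eq (h : Diagonalizes U l ((1 / T) • shifted H Q μ))
    (A B : Matrix (Fin d) (Fin d) ℂ) :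
    (fdOp T H Q μ * tentChannel T H Q μ A * (1 - fdOp T H Q μ) * B).trace =
      ∑ a, ∑ b,
        ((fdWeight 0 (l a) * tentTransform (l a - l b) * fdWeight 1 (l b) : ℝ) : ℂ) *
        ((U.conjTranspose * A * U) a b * (U.conjTranspose * B * U) b a) := by
  rw [h.one_sub_fdOp_eq, h.fdOp_eq, h.tentChannel_eq, h.trace_conj]
  refine Finset.sum_congr rfl fun a _ => Finset.sum_congr rfl fun b _ => ?_
  rw [Matrix.hadamard_apply, tentKernel, Matrix.of_apply]
  push_cast
  ring

theorem conj_conjTranspose_mul_mul_apply {A : Matrix (Fin d) (Fin d) ℂ} (hA : A.IsHermitian)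
    (U : Matrix (Fin d) (Fin d) ℂ) (a b : Fin d) :
    (starRingEnd ℂ) ((U.conjTranspose * A * U) a b) = (U.conjTranspose * A * U) b a := by
  have h : (U.conjTranspose * A * U).IsHermitian :=
    Matrix.isHermitian_conjTranspose_mul_mul U hA
  exact h.apply b a

/-- For Hermitian A and B, conjugation swaps the indices a and b in the double sum, and the kernel
is symmetric. -/
theorem Diagonalizes.integral_trace_im (h : Diagonalizes U l ((1 / T) • shifted H Q μ))
    {A B : Matrix (Fin d) (Fin d) ℂ} (hA : A.IsHermitian) (hB : B.IsHermitian) :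
    (∫ s in (0 : ℝ)..1,
      (fdOpAt T H Q μ s * A * fdOpAt T H Q μ (1 - s) * B).trace).im = 0 := by
  rw [← Complex.conj_eq_iff_im, h.integral_trace_eq, map_sum, Finset.sum_comm]
  refine Finset.sum_congr rfl fun b _ => ?_
  rw [map_sum]
  refine Finset.sum_congr rfl fun a _ => ?_
  rw [map_mul, map_mul, Complex.conj_ofReal, conj_conjTranspose_mul_mul_apply hA,
    conj_conjTranspose_mul_mul_apply hB, hessianKernel_comm]

theorem Diagonalizes.re_integral_trace_eq (h : Diagonalizes U l ((1 / T) • shifted H Q μ))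
    {A B : Matrix (Fin d) (Fin d) ℂ} (hA : A.IsHermitian) (hB : B.IsHermitian) :
    (∫ s in (0 : ℝ)..1, (fdOpAt T H Q μ s * A * fdOpAt T H Q μ (1 - s) * B).trace).re =
      (fdOp T H Q μ * tentChannel T H Q μ A * (1 - fdOp T H Q μ) * B).trace.re := by
  rw [h.integral_trace_eq, h.trace_tentChannel_eq]
  simp only [Complex.re_sum, Complex.re_ofReal_mul]
  set r : Fin d → Fin d → ℝ := fun a b =>
    ((U.conjTranspose * A * U) a b * (U.conjTranspose * B * U) b a).re with hr
  set g : Fin d → Fin d → ℝ := fun a b =>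
    fdWeight 0 (l a) * tentTransform (l a - l b) * fdWeight 1 (l b) with hg
  have hrs : ∀ a b, r a b = r b a := by
    intro a b
    simp only [hr]
    rw [← Complex.conj_re, map_mul, conj_conjTranspose_mul_mul_apply hA,
      conj_conjTranspose_mul_mul_apply hB]
  -- Against the symmetric array `r`, the kernel `g` and its transpose have the same sum, so `g` may
  -- be replaced by its symmetrization.
  have hsum : ∑ a, ∑ b, g a b * r a b = ∑ a, ∑ b, g b a * r a b := by
    rw [Finset.sum_comm]
    exact Finset.sum_congr rfl fun a _ => Finset.sum_congr rfl fun b _ => by rw [hrs]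
  have h2 : 2 * ∑ a, ∑ b, hessianKernel (l a) (l b) * r a b =
      ∑ a, ∑ b, g a b * r a b + ∑ a, ∑ b, g b a * r a b := by
    simp only [Finset.mul_sum, ← Finset.sum_add_distrib]
    refine Finset.sum_congr rfl fun a _ => Finset.sum_congr rfl fun b _ => ?_
    rw [← mul_assoc, ← fdWeight_mul_tentTransform_add_swap, add_mul]
  change ∑ a, ∑ b, hessianKernel (l a) (l b) * r a b = ∑ a, ∑ b, g a b * r a b
  linarith

end Diagonalization

end FermiDirac

end

theorem mainTheorem9 {c d : ℕ} (T : ℝ) (hT : 0 < T)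
    (H : Matrix (Fin d) (Fin d) ℂ) (hH : H.IsHermitian)
    (Q : Fin c → Matrix (Fin d) (Fin d) ℂ) (hQ : ∀ i, (Q i).IsHermitian)
    (q : Fin c → ℝ) :
    FermiDirac.IsProbabilityDensity FermiDirac.highPeakTent ∧
    ContDiff ℝ 2 (FermiDirac.dualObjective T H Q q) ∧
    ∀ μ : Fin c → ℝ,
      (∀ s ∈ Set.Icc (0 : ℝ) 1, FermiDirac.IsMeasurementOperator (FermiDirac.fdOpAt T H Q μ s)) ∧
      FermiDirac.IsQuantumChannel (FermiDirac.tentChannel T H Q μ) ∧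
      ∀ i j : Fin c,
        ((FermiDirac.partialDeriv i
            (FermiDirac.partialDeriv j (FermiDirac.dualObjective T H Q q)) μ : ℝ) : ℂ) =
          -(1 / (T : ℂ)) * ∫ s in (0 : ℝ)..1,
            (FermiDirac.fdOpAt T H Q μ s * Q i * FermiDirac.fdOpAt T H Q μ (1 - s) * Q j).trace ∧
        FermiDirac.partialDeriv i
            (FermiDirac.partialDeriv j (FermiDirac.dualObjective T H Q q)) μ =
          -(1 / T) * (FermiDirac.fdOp T H Q μ * FermiDirac.tentChannel T H Q μ (Q i) *
            (1 - FermiDirac.fdOp T H Q μ) * Q j).trace.re := by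
  refine ⟨FermiDirac.isProbabilityDensity_highPeakTent,
    FermiDirac.contDiff_dualObjective hH hQ, fun μ => ?_⟩
  obtain ⟨U, l, h⟩ := FermiDirac.exists_diagonalizes (FermiDirac.isHermitian_real_smul
    (FermiDirac.isHermitian_shifted hH hQ μ) (1 / T))
  refine ⟨fun s hs => h.isMeasurementOperator_fdOpAt hs, h.isQuantumChannel_tentChannel,
    fun i j => ⟨?_, ?_⟩⟩
  · rw [FermiDirac.partialDeriv_partialDeriv_dualObjective hT hH hQ]
    -- The real parts agree by the derivative formula; the imaginary part of the integral vanishes.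
    apply Complex.ext
    · rw [Complex.ofReal_re, show -(1 / (T : ℂ)) = ((-(1 / T) : ℝ) : ℂ) by push_cast; rfl,
        Complex.re_ofReal_mul]
    · rw [Complex.ofReal_im, show -(1 / (T : ℂ)) = ((-(1 / T) : ℝ) : ℂ) by push_cast; rfl,
        Complex.im_ofReal_mul, h.integral_trace_im (hQ i) (hQ j), mul_zero]
  · rw [FermiDirac.partialDeriv_partialDeriv_dualObjective hT hH hQ,
      h.re_integral_trace_eq (hQ i) (hQ j)]
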